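/- All topological spaces carry their Borel $\sigma$-algebras, products carry product $\sigma$-algebras and subsets carry trace $\sigma$-algebras. A stochastic relation $K: X\rightsquigarrow Y$ between measurable spaces is a map that assigns to each $x\in X$ a measure $K(x)$ on $Y$ with $K(x)(Y)\le 1$, such that $x\mapsto K(x)(D)$ is measurable for each measurable $D\subseteq Y$. A morphism $(f,g): K\to L$ from $K: X\rightsquigarrow Y$ to $L: X'\rightsquigarrow Y'$ consists of measurable maps $f: X\to X'$ and $g: Y\to Y'$ with $L(f(x))(D)=K(x)(g^{-1}[D])$ for all $x\in X$ and all measurable $D\subseteq Y'$; morphisms are composed componentwise. Proposition. Let $K_i: X_i\rightsquigarrow Y_i$ ($i=1,2$) be stochastic relations over Polish spaces $X_i, Y_i$, let $K: X\rightsquigarrow Y$ be a stochastic relation over second countable metric spaces $X, Y$, and let $m_i=(f_i,g_i): K_i\to K$ ($i=1,2$) be morphisms. Put $$A:=\{(x_1,x_2)\in X_1\times X_2 \mid f_1(x_1)=f_2(x_2)\},\qquad B:=\{(y_1,y_2)\in Y_1\times Y_2 \mid g_1(y_1)=g_2(y_2)\}.$$ Then there are finer Polish topologies on $X_1$ and $X_2$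 with the same Borel sets such that $A$ is closed in $X_1\times X_2$ for the product of these topologies, so that $A$ is a Polish space whose Borel sets form the trace $\sigma$-algebra; and likewise for $Y_1$, $Y_2$ and $B$. Moreover, there is a stochastic relation $M: A\rightsquigarrow B$ such that, with the coordinate projections $\rho_i: A\to X_i$ and $\zeta_i: B\to Y_i$, the pairs $m_i^+:=(\rho_i,\zeta_i)$ are morphisms $M\to K_i$ ($i=1,2$) and $m_1\circ m_1^+=m_2\circ m_2^+$. In particular, every such cospan of stochastic relations has a semi-pullback over Polish spaces. -/

import Mathlib

open MeasureTheory ProbabilityTheory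

/-- A stochastic relation `K : X ⇝ Y`: a measurable map from `X` to the subprobability
measures on `Y`. -/
structure StochRel (X Y : Type*) [MeasurableSpace X] [MeasurableSpace Y] where
  kernel : Kernel X Y
  apply_univ_le_one : ∀ x, kernel x Set.univ ≤ 1

namespace StochRel

variable {X₁ Y₁ X₂ Y₂ X₃ Y₃ : Type*}
  [MeasurableSpace X₁] [MeasurableSpace Y₁] [MeasurableSpace X₂] [MeasurableSpace Y₂]
  [MeasurableSpace X₃] [MeasurableSpace Y₃]

/-- A morphism `(f, g) : K → L` of stochastic relations: measurable maps on the source spaces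
and on the target spaces such that `L (f x)` is the image measure of `K x` under `g`. -/
@[ext]
structure Hom (K : StochRel X₁ Y₁) (L : StochRel X₂ Y₂) where
  src : X₁ → X₂
  tgt : Y₁ → Y₂
  measurable_src : Measurable src
  measurable_tgt : Measurable tgt
  comm : ∀ x, L.kernel (src x) = (K.kernel x).map tgt

/-- Composition of morphisms, `n.comp m` being `n` after `m`. -/
def Hom.comp {K : StochRel X₁ Y₁} {L : StochRel X₂ Y₂} {M : StochRel X₃ Y₃}
    (n : Hom L M) (m : Hom K L) : Hom K M where
  src := n.src ∘ m.src
  tgt := n.tgt ∘ m.tgt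
  measurable_src := n.measurable_src.comp m.measurable_src
  measurable_tgt := n.measurable_tgt.comp m.measurable_tgt
  comm x := by
    rw [Function.comp_apply, n.comm, m.comm, Measure.map_map n.measurable_tgt m.measurable_tgt]

end StochRel

/-- The set of pairs `(a, b)` with `f a = g b`. -/
def fiberProduct {α β γ : Type*} (f : α → γ) (g : β → γ) : Set (α × β) :=
  {p | f p.1 = g p.2}

/-- `t` is a Polish topology finer than the topology `t₀`, and its Borel sets are the given
σ-algebra (which in the intended use is the Borel σ-algebra of `t₀`). -/
structure IsPolishRefinement {α : Type*} [m : MeasurableSpace α]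
    (t₀ t : TopologicalSpace α) : Prop where
  finer : t ≤ t₀
  polish : @PolishSpace α t
  borel : @BorelSpace α t m

/-- There are finer Polish topologies on `α` and `β`, with the same Borel sets, for which `S` is
closed in the product; with the subspace topology `S` is then a Polish space whose Borel sets
are the members of the subspace σ-algebra of the product σ-algebra. -/
def IsClosedUpToPolishRefinement {α β : Type*} [t₀α : TopologicalSpace α] [MeasurableSpace α]
    [t₀β : TopologicalSpace β] [MeasurableSpace β] (S : Set (α × β)) : Prop :=
  ∃ (tα : TopologicalSpace α) (tβ : TopologicalSpace β),
    IsPolishRefinement t₀α tα ∧ IsPolishRefinement t₀β tβ ∧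
    @IsClosed (α × β) (@instTopologicalSpaceProd α β tα tβ) S ∧
    @PolishSpace S (TopologicalSpace.induced Subtype.val (@instTopologicalSpaceProd α β tα tβ)) ∧
    @BorelSpace S (TopologicalSpace.induced Subtype.val (@instTopologicalSpaceProd α β tα tβ))
      Subtype.instMeasurableSpace

/-! Refining the Polish topologies makes the maps continuous, so each fiber product becomes closed
as an equalizer into a Hausdorff space. For `(x₁, x₂)` in `A`, the measures `K₁ x₁` and `K₂ x₂` have
the same image on `Y`, namely `K (f₁ x₁) = K (f₂ x₂)`. Disintegrate both over this image and glue
them conditionally independently: the result has the right marginals and lives on `B`.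
Disintegrating kernels rather than single measures makes the gluing measurable in `(x₁, x₂)`; for
this `Y` need only be countably generated, while standard Borel `Y₁`, `Y₂` supply the conditional
kernels. -/

theorem Measurable.exists_isPolishRefinement_continuous {α γ : Type*}
    [t₀ : TopologicalSpace α] [hp₀ : PolishSpace α] [MeasurableSpace α] [hb₀ : BorelSpace α]
    [TopologicalSpace γ] [SecondCountableTopology γ] [MeasurableSpace γ] [OpensMeasurableSpace γ]
    {f : α → γ} (hf : Measurable f) :
    ∃ t : TopologicalSpace α, IsPolishRefinement t₀ t ∧ @Continuous α γ t _ f := by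
  obtain ⟨t, ht, hfc, hp⟩ := hf.exists_continuous
  refine ⟨t, ⟨ht, hp, @BorelSpace.mk α t _ ?_⟩, hfc⟩
  -- Comparable Polish topologies have the same Borel sets (Lusin–Souslin).
  rw [borel_eq_borel_of_le hp hp₀ ht]
  exact hb₀.measurable_eq

theorem Measurable.isClosedUpToPolishRefinement_fiberProduct {α β γ : Type*}
    [TopologicalSpace α] [PolishSpace α] [MeasurableSpace α] [BorelSpace α]
    [TopologicalSpace β] [PolishSpace β] [MeasurableSpace β] [BorelSpace β]
    [TopologicalSpace γ] [T2Space γ] [SecondCountableTopology γ] [MeasurableSpace γ]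
    [OpensMeasurableSpace γ] {f : α → γ} {g : β → γ} (hf : Measurable f) (hg : Measurable g) :
    IsClosedUpToPolishRefinement (fiberProduct f g) := by
  obtain ⟨tα, hα, hfc⟩ := hf.exists_isPolishRefinement_continuous
  obtain ⟨tβ, hβ, hgc⟩ := hg.exists_isPolishRefinement_continuous
  refine ⟨tα, tβ, hα, hβ, ?_⟩
  have := hα.polish
  have := hα.borel
  have := hβ.polish
  have := hβ.borel
  have hc : @IsClosed (α × β) (@instTopologicalSpaceProd α β tα tβ) (fiberProduct f g) :=
    isClosed_eq (hfc.comp continuous_fst) (hgc.comp continuous_snd)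
  exact ⟨hc, hc.polishSpace, inferInstance⟩

namespace ProbabilityTheory.Kernel

/-- Disintegration of a finite kernel along a measurable map on its target space. -/
theorem exists_isMarkovKernel_map_compProd_eq_map_graph {α Ω β : Type*} [MeasurableSpace α]
    [MeasurableSpace Ω] [StandardBorelSpace Ω] [Nonempty Ω] [MeasurableSpace β]
    [MeasurableSpace.CountablyGenerated β] (κ : Kernel α Ω) [IsFiniteKernel κ]
    {g : Ω → β} (hg : Measurable g) :
    ∃ c : Kernel (α × β) Ω, IsMarkovKernel c ∧ κ.map g ⊗ₖ c = κ.map (fun ω => (g ω, ω)) := by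
  refine ⟨(κ.map fun ω => (g ω, ω)).condKernel, inferInstance, ?_⟩
  have h : (κ.map fun ω => (g ω, ω)).fst = κ.map g := by
    rw [fst_eq, ← map_comp_right _ (by fun_prop) measurable_fst]
    rfl
  rw [← h]
  exact disintegrate _ _

/-- Each fiber of `d` has mass one, so forgetting its coordinate costs no mass. -/
theorem map_compProd_prod_fst {α β γ δ : Type*} [MeasurableSpace α] [MeasurableSpace β]
    [MeasurableSpace γ] [MeasurableSpace δ] (ν : Kernel α β) [IsSFiniteKernel ν]
    (c : Kernel (α × β) γ) [IsSFiniteKernel c] (d : Kernel (α × β) δ) [IsMarkovKernel d] :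
    (ν ⊗ₖ (c ×ₖ d)).map (fun p => (p.1, p.2.1)) = ν ⊗ₖ c := by
  ext a s hs
  have hm : Measurable fun p : β × γ × δ => (p.1, p.2.1) := by fun_prop
  rw [map_apply' _ hm _ hs, compProd_apply (hm hs), compProd_apply hs]
  refine lintegral_congr fun b => ?_
  conv_rhs => rw [← fst_prod c d, fst_apply' _ _ (measurable_prodMk_left hs)]
  rfl

theorem map_compProd_prod_snd {α β γ δ : Type*} [MeasurableSpace α] [MeasurableSpace β]
    [MeasurableSpace γ] [MeasurableSpace δ] (ν : Kernel α β) [IsSFiniteKernel ν]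
    (c : Kernel (α × β) γ) [IsMarkovKernel c] (d : Kernel (α × β) δ) [IsSFiniteKernel d] :
    (ν ⊗ₖ (c ×ₖ d)).map (fun p => (p.1, p.2.2)) = ν ⊗ₖ d := by
  ext a s hs
  have hm : Measurable fun p : β × γ × δ => (p.1, p.2.2) := by fun_prop
  rw [map_apply' _ hm _ hs, compProd_apply (hm hs), compProd_apply hs]
  refine lintegral_congr fun b => ?_
  conv_rhs => rw [← snd_prod c d, snd_apply' _ _ (measurable_prodMk_left hs)]
  rfl

/-- Two finite kernels with the same image under measurable maps into a countably generated
space have a coupling concentrated on the set where the two maps agree: the conditional product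
over the common image. -/
theorem exists_map_eq_and_ae_eq_of_map_eq {α Ω₁ Ω₂ β : Type*} [MeasurableSpace α]
    [MeasurableSpace Ω₁] [StandardBorelSpace Ω₁] [MeasurableSpace Ω₂] [StandardBorelSpace Ω₂]
    [MeasurableSpace β] [MeasurableSpace.CountablyGenerated β] [MeasurableEq β]
    (κ₁ : Kernel α Ω₁) [IsFiniteKernel κ₁] (κ₂ : Kernel α Ω₂) [IsFiniteKernel κ₂]
    {g₁ : Ω₁ → β} {g₂ : Ω₂ → β} (hg₁ : Measurable g₁) (hg₂ : Measurable g₂)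
    (h : κ₁.map g₁ = κ₂.map g₂) :
    ∃ N : Kernel α (Ω₁ × Ω₂), N.map Prod.fst = κ₁ ∧ N.map Prod.snd = κ₂ ∧
      ∀ a, ∀ᵐ p ∂N a, g₁ p.1 = g₂ p.2 := by
  -- Disintegration needs nonempty target spaces. If one is empty, both kernels vanish, because
  -- equal images force equal total masses, and the zero coupling works.
  have key : (∀ a, κ₁ a Set.univ = 0) ↔ ∀ a, κ₂ a Set.univ = 0 := by
    refine forall_congr' fun a => ?_
    have := congr_arg (fun κ => κ a Set.univ) h
    simp only [map_apply' _ hg₁ _ MeasurableSet.univ, map_apply' _ hg₂ _ MeasurableSet.univ,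
      Set.preimage_univ] at this
    rw [this]
  have of_zero (h₁ : ∀ a, κ₁ a Set.univ = 0) :
      ∃ N : Kernel α (Ω₁ × Ω₂), N.map Prod.fst = κ₁ ∧ N.map Prod.snd = κ₂ ∧
        ∀ a, ∀ᵐ p ∂N a, g₁ p.1 = g₂ p.2 := by
    refine ⟨0, ?_, ?_, by simp⟩
    · rw [map_zero]
      ext1 a
      exact (Measure.measure_univ_eq_zero.1 (h₁ a)).symm
    · rw [map_zero]
      ext1 a
      exact (Measure.measure_univ_eq_zero.1 (key.1 h₁ a)).symm
  rcases isEmpty_or_nonempty Ω₁ with _ | _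
  · exact of_zero fun a => by simp [Measure.eq_zero_of_isEmpty]
  rcases isEmpty_or_nonempty Ω₂ with _ | _
  · exact of_zero (key.2 fun a => by simp [Measure.eq_zero_of_isEmpty])
  obtain ⟨c₁, _, hc₁⟩ := exists_isMarkovKernel_map_compProd_eq_map_graph κ₁ hg₁
  obtain ⟨c₂, _, hc₂⟩ := exists_isMarkovKernel_map_compProd_eq_map_graph κ₂ hg₂
  -- Choose the common image point, then independent points in the two fibers over it.
  set N := κ₁.map g₁ ⊗ₖ (c₁ ×ₖ c₂) with hN
  have h₁ : N.map (fun p => (p.1, p.2.1)) = κ₁.map (fun ω => (g₁ ω, ω)) := by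
    rw [hN, map_compProd_prod_fst, hc₁]
  have h₂ : N.map (fun p => (p.1, p.2.2)) = κ₂.map (fun ω => (g₂ ω, ω)) := by
    rw [hN, map_compProd_prod_snd, h, hc₂]
  -- By `h₁`, this marginal of `N` is carried by the graph of `g₁`.
  have ae₁ (a : α) : ∀ᵐ p ∂N a, p.1 = g₁ p.2.1 := by
    have hs : MeasurableSet {q : β × Ω₁ | q.1 = g₁ q.2} :=
      measurableSet_eq_fun measurable_fst (hg₁.comp measurable_snd)
    have : ∀ᵐ q ∂N.map (fun p => (p.1, p.2.1)) a, q.1 = g₁ q.2 := by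
      rw [h₁, map_apply _ (by fun_prop), ae_map_iff (by fun_prop) hs]
      simp
    rwa [map_apply _ (by fun_prop), ae_map_iff (by fun_prop) hs] at this
  have ae₂ (a : α) : ∀ᵐ p ∂N a, p.1 = g₂ p.2.2 := by
    have hs : MeasurableSet {q : β × Ω₂ | q.1 = g₂ q.2} :=
      measurableSet_eq_fun measurable_fst (hg₂.comp measurable_snd)
    have : ∀ᵐ q ∂N.map (fun p => (p.1, p.2.2)) a, q.1 = g₂ q.2 := by
      rw [h₂, map_apply _ (by fun_prop), ae_map_iff (by fun_prop) hs]
      simp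
    rwa [map_apply _ (by fun_prop), ae_map_iff (by fun_prop) hs] at this
  refine ⟨N.map Prod.snd, ?_, ?_, fun a => ?_⟩
  · have := congr_arg (fun κ => κ.map Prod.snd) h₁
    simp only [← map_comp_right _ (show Measurable fun p : β × Ω₁ × Ω₂ => (p.1, p.2.1) by fun_prop)
      measurable_snd, ← map_comp_right _ (show Measurable fun ω => (g₁ ω, ω) by fun_prop)
      measurable_snd] at this
    rw [← map_comp_right _ measurable_snd measurable_fst]
    exact this.trans (map_id _)
  · have := congr_arg (fun κ => κ.map Prod.snd) h₂
    simp only [← map_comp_right _ (show Measurable fun p : β × Ω₁ × Ω₂ => (p.1, p.2.2) by fun_prop)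
      measurable_snd, ← map_comp_right _ (show Measurable fun ω => (g₂ ω, ω) by fun_prop)
      measurable_snd] at this
    rw [← map_comp_right _ measurable_snd measurable_snd]
    exact this.trans (map_id _)
  · have hs : MeasurableSet {p : Ω₁ × Ω₂ | g₁ p.1 = g₂ p.2} :=
      measurableSet_eq_fun (hg₁.comp measurable_fst) (hg₂.comp measurable_snd)
    rw [map_apply _ measurable_snd, ae_map_iff measurable_snd.aemeasurable hs]
    filter_upwards [ae₁ a, ae₂ a] with p hp₁ hp₂
    rw [← hp₁, hp₂]

/-- A kernel concentrated on a measurable set factors through the inclusion of that set. -/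
theorem exists_map_subtype_val_eq {α β : Type*} [MeasurableSpace α] [MeasurableSpace β]
    (N : Kernel α β) {s : Set β} (hs : MeasurableSet s) (h : ∀ a, ∀ᵐ b ∂N a, b ∈ s) :
    ∃ M : Kernel α s, M.map Subtype.val = N := by
  refine ⟨N.comapRight (MeasurableEmbedding.subtype_coe hs), ?_⟩
  ext1 a
  rw [map_apply _ measurable_subtype_coe, comapRight_apply,
    (MeasurableEmbedding.subtype_coe hs).map_comap, Subtype.range_coe,
    Measure.restrict_eq_self_of_ae_mem (h a)]

end ProbabilityTheory.Kernel

theorem mainTheorem2 {X₁ Y₁ X₂ Y₂ X Y : Type*}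
    [TopologicalSpace X₁] [PolishSpace X₁] [MeasurableSpace X₁] [BorelSpace X₁]
    [TopologicalSpace Y₁] [PolishSpace Y₁] [MeasurableSpace Y₁] [BorelSpace Y₁]
    [TopologicalSpace X₂] [PolishSpace X₂] [MeasurableSpace X₂] [BorelSpace X₂]
    [TopologicalSpace Y₂] [PolishSpace Y₂] [MeasurableSpace Y₂] [BorelSpace Y₂]
    [MetricSpace X] [SecondCountableTopology X] [MeasurableSpace X] [BorelSpace X]
    [MetricSpace Y] [SecondCountableTopology Y] [MeasurableSpace Y] [BorelSpace Y]
    (K₁ : StochRel X₁ Y₁) (K₂ : StochRel X₂ Y₂) (K : StochRel X Y)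
    (m₁ : StochRel.Hom K₁ K) (m₂ : StochRel.Hom K₂ K) :
    IsClosedUpToPolishRefinement (fiberProduct m₁.src m₂.src) ∧
    IsClosedUpToPolishRefinement (fiberProduct m₁.tgt m₂.tgt) ∧
    ∃ (M : StochRel (fiberProduct m₁.src m₂.src) (fiberProduct m₁.tgt m₂.tgt))
      (p₁ : StochRel.Hom M K₁) (p₂ : StochRel.Hom M K₂),
      (p₁.src = fun a => a.1.1) ∧ (p₁.tgt = fun b => b.1.1) ∧
      (p₂.src = fun a => a.1.2) ∧ (p₂.tgt = fun b => b.1.2) ∧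
      m₁.comp p₁ = m₂.comp p₂ := by
  refine ⟨m₁.measurable_src.isClosedUpToPolishRefinement_fiberProduct m₂.measurable_src,
    m₁.measurable_tgt.isClosedUpToPolishRefinement_fiberProduct m₂.measurable_tgt, ?_⟩
  have fin₁ : IsFiniteKernel K₁.kernel := ⟨1, ENNReal.one_lt_top, K₁.apply_univ_le_one⟩
  have fin₂ : IsFiniteKernel K₂.kernel := ⟨1, ENNReal.one_lt_top, K₂.apply_univ_le_one⟩
  have hρ₁ : Measurable fun a : fiberProduct m₁.src m₂.src => a.1.1 := by fun_prop
  have hρ₂ : Measurable fun a : fiberProduct m₁.src m₂.src => a.1.2 := by fun_prop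
  have hζ₁ : Measurable fun b : fiberProduct m₁.tgt m₂.tgt => b.1.1 := by fun_prop
  have hζ₂ : Measurable fun b : fiberProduct m₁.tgt m₂.tgt => b.1.2 := by fun_prop
  have himg : (K₁.kernel.comap _ hρ₁).map m₁.tgt = (K₂.kernel.comap _ hρ₂).map m₂.tgt := by
    ext1 a
    rw [Kernel.map_apply _ m₁.measurable_tgt, Kernel.map_apply _ m₂.measurable_tgt,
      Kernel.comap_apply, Kernel.comap_apply, ← m₁.comm, ← m₂.comm]
    exact congr_arg K.kernel a.2
  obtain ⟨N, hN₁, hN₂, hN⟩ := Kernel.exists_map_eq_and_ae_eq_of_map_eq _ _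
    m₁.measurable_tgt m₂.measurable_tgt himg
  have hB : MeasurableSet (fiberProduct m₁.tgt m₂.tgt) :=
    measurableSet_eq_fun (m₁.measurable_tgt.comp measurable_fst)
      (m₂.measurable_tgt.comp measurable_snd)
  obtain ⟨M, rfl⟩ := N.exists_map_subtype_val_eq hB hN
  rw [← Kernel.map_comp_right _ measurable_subtype_coe measurable_fst] at hN₁
  rw [← Kernel.map_comp_right _ measurable_subtype_coe measurable_snd] at hN₂
  have comm₁ (a) : K₁.kernel a.1.1 = (M a).map fun b => b.1.1 := by
    rw [← Kernel.comap_apply K₁.kernel hρ₁, ← hN₁]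
    exact Kernel.map_apply _ hζ₁ a
  have comm₂ (a) : K₂.kernel a.1.2 = (M a).map fun b => b.1.2 := by
    rw [← Kernel.comap_apply K₂.kernel hρ₂, ← hN₂]
    exact Kernel.map_apply _ hζ₂ a
  -- Image measures keep total mass, so the bound passes from `K₁` to `M`.
  have hM (a) : M a Set.univ ≤ 1 := by
    have := K₁.apply_univ_le_one a.1.1
    rwa [comm₁, Measure.map_apply hζ₁ MeasurableSet.univ] at this
  refine ⟨⟨M, hM⟩, ⟨_, _, hρ₁, hζ₁, comm₁⟩, ⟨_, _, hρ₂, hζ₂, comm₂⟩, rfl, rfl, rfl, rfl, ?_⟩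
  ext p
  · exact p.2
  · exact p.2
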